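/- Let $G$ be a finite group. Its Burnside ring $B(G)$ is the Grothendieck ring of the semiring of isomorphism classes of finite $G$-sets under disjoint union and Cartesian product; $[X]$ is the class of a finite $G$-set $X$. For a subgroup $K\le G$ let $\varphi^G_K\colon B(G)\to\mathbb Z$ be the ring homomorphism with $\varphi^G_K([X])=\#\{x\in X\mid kx=x\text{ for all }k\in K\}$. Let $\mathrm{Nsub}(G)$ be the set of normal subgroups of $G$, and let $B(G,\mathrm{Nsub}(G))$ be the subring of $B(G)$ spanned over $\mathbb Z$ by the elements $[G/N]$ with $N\in\mathrm{Nsub}(G)$. The group $G$ is called $2$-seminilpotent if for every subgroup $K\le G$ of even index there is a normal subgroup $N$ of $G$ with $K\le N$ and $|G:N|=2$, and the number of such $N$ is odd. Theorem. Let $G$ be a $2$-seminilpotent finite group of even order $n$, and let $C$ be a cyclic group of order $n$. There is a unique ring homomorphism $\alpha\colon B(C)\to B(G)$ (the Frobenius–Wielandt homomorphism) such that $\varphi^G_K(\alpha(x))=\varphi^C_{C_{|K|}}(x)$ for all $x\in B(C)$ and all subgroups $K\le G$, where $C_{|K|}$ is the subgroup of $C$ of order $|K|$. It satisfies \[ \alpha(B(C)^\times)\subseteq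 B(G,\mathrm{Nsub}(G))^\times . \] Moreover, with $u_N=1-[G/N]$, the product $\prod_{N\le G,\ |G:N|=2}u_N$ is a unit of $B(G)$, and \[ \alpha(B(C)^\times)=\Bigl\langle -1,\ \prod_{N\le G,\ |G:N|=2}u_N\Bigr\rangle . \] -/

import Mathlib

open Algebra

universe u v

noncomputable section

/-! ### The Grothendieck ring of a commutative semiring -/

/-- The Grothendieck ring of a commutative semiring `S`: the Grothendieck group of `(S, +)`
(formal differences), with the biadditive extension of the multiplication of `S`. -/
def GrothendieckRing (S : Type u) [CommSemiring S] : Type u := GrothendieckAddGroup S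

namespace GrothendieckRing

variable {S : Type u} [CommSemiring S]

instance : AddCommGroup (GrothendieckRing S) :=
  inferInstanceAs (AddCommGroup (GrothendieckAddGroup S))

/-- The canonical additive map `S → GrothendieckRing S`. -/
def ofAdd : S →+ GrothendieckRing S := (GrothendieckAddGroup.of : S →+ GrothendieckAddGroup S)

/-- Extension of an additive map to an abelian group. -/
def liftAdd {A : Type v} [AddCommGroup A] (f : S →+ A) : GrothendieckRing S →+ A :=
  (GrothendieckAddGroup.lift f : GrothendieckAddGroup S →+ A)

theorem liftAdd_ofAdd {A : Type v} [AddCommGroup A] (f : S →+ A) (a : S) :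
    liftAdd f (ofAdd a) = f a :=
  DFunLike.congr_fun (GrothendieckAddGroup.lift.symm_apply_apply f) a

theorem exists_sub (x : GrothendieckRing S) : ∃ a b : S, x = ofAdd a - ofAdd b := by
  obtain ⟨⟨a, b⟩, h⟩ := (AddLocalization.addMonoidOf (⊤ : AddSubmonoid S)).surj x
  exact ⟨a, b, eq_sub_of_add_eq h⟩

/-- The multiplication, as a biadditive map. -/
def mulHom : GrothendieckRing S →+ GrothendieckRing S →+ GrothendieckRing S :=
  liftAdd
    { toFun := fun a => liftAdd (ofAdd.comp (AddMonoidHom.mulLeft a))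
      map_zero' := by
        ext x
        obtain ⟨b, c, rfl⟩ := exists_sub x
        simp [liftAdd_ofAdd]
      map_add' := fun a a' => by
        ext x
        obtain ⟨b, c, rfl⟩ := exists_sub x
        simp only [map_sub, liftAdd_ofAdd, AddMonoidHom.add_apply, AddMonoidHom.comp_apply,
          AddMonoidHom.coe_mulLeft, add_mul, map_add] }

instance : Mul (GrothendieckRing S) := ⟨fun x y => mulHom x y⟩

instance : One (GrothendieckRing S) := ⟨ofAdd 1⟩

theorem ofAdd_mul (a b : S) : (ofAdd (a * b) : GrothendieckRing S) = ofAdd a * ofAdd b := by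
  change _ = mulHom (ofAdd a) (ofAdd b)
  simp [mulHom, liftAdd_ofAdd]

instance : NonUnitalNonAssocRing (GrothendieckRing S) :=
  { (inferInstance : AddCommGroup (GrothendieckRing S)),
    (inferInstance : Mul (GrothendieckRing S)) with
    left_distrib := fun x y z => map_add (mulHom x) y z
    right_distrib := fun x y z => by
      change mulHom (x + y) z = mulHom x z + mulHom y z
      rw [map_add, AddMonoidHom.add_apply]
    zero_mul := fun x => by
      change mulHom 0 x = 0
      rw [map_zero, AddMonoidHom.zero_apply]
    mul_zero := fun x => map_zero (mulHom x) }

theorem one_def : (1 : GrothendieckRing S) = ofAdd 1 := rfl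

instance : CommRing (GrothendieckRing S) :=
  { (inferInstance : NonUnitalNonAssocRing (GrothendieckRing S)),
    (inferInstance : One (GrothendieckRing S)) with
    mul_assoc := fun x y z => by
      obtain ⟨a, a', rfl⟩ := exists_sub x
      obtain ⟨b, b', rfl⟩ := exists_sub y
      obtain ⟨c, c', rfl⟩ := exists_sub z
      simp only [sub_mul, mul_sub, ← ofAdd_mul, mul_assoc]
    one_mul := fun x => by
      obtain ⟨a, a', rfl⟩ := exists_sub x
      rw [one_def, mul_sub, ← ofAdd_mul, ← ofAdd_mul, one_mul, one_mul]
    mul_one := fun x => by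
      obtain ⟨a, a', rfl⟩ := exists_sub x
      rw [one_def, sub_mul, ← ofAdd_mul, ← ofAdd_mul, mul_one, mul_one]
    mul_comm := fun x y => by
      obtain ⟨a, a', rfl⟩ := exists_sub x
      obtain ⟨b, b', rfl⟩ := exists_sub y
      simp only [sub_mul, mul_sub, ← ofAdd_mul]
      rw [mul_comm a b, mul_comm a b', mul_comm a' b, mul_comm a' b']
      abel }

/-- The canonical semiring homomorphism `S → GrothendieckRing S`. -/
def of : S →+* GrothendieckRing S :=
  { (ofAdd : S →+ GrothendieckRing S) with
    map_one' := rfl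
    map_mul' := ofAdd_mul }

/-- Extension of a semiring homomorphism to a commutative ring. -/
def lift {R : Type v} [CommRing R] (f : S →+* R) : GrothendieckRing S →+* R :=
  { liftAdd f.toAddMonoidHom with
    map_one' := (liftAdd_ofAdd f.toAddMonoidHom 1).trans (map_one f)
    map_mul' := fun x y => by
      change liftAdd f.toAddMonoidHom (x * y) =
        liftAdd f.toAddMonoidHom x * liftAdd f.toAddMonoidHom y
      obtain ⟨a, a', rfl⟩ := exists_sub x
      obtain ⟨b, b', rfl⟩ := exists_sub y
      simp only [sub_mul, mul_sub, ← ofAdd_mul, map_sub, liftAdd_ofAdd]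
      simp }

end GrothendieckRing

/-! ### Finite `G`-sets and the Burnside ring -/

/-- A finite (left) `G`-set. -/
structure FinGSet (G : Type u) [Group G] where
  (carrier : Type u)
  [action : MulAction G carrier]
  [finite : Finite carrier]

attribute [instance] FinGSet.action FinGSet.finite

/-- Isomorphism of finite `G`-sets: an equivariant bijection. -/
instance FinGSet.isoSetoid (G : Type u) [Group G] : Setoid (FinGSet G) where
  r X Y := ∃ e : X.carrier ≃ Y.carrier, ∀ (g : G) (x : X.carrier), e (g • x) = g • e x
  iseqv :=
    { refl := fun X => ⟨Equiv.refl _, fun _ _ => rfl⟩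
      symm := fun {X Y} ⟨e, he⟩ => ⟨e.symm, fun g y => by
        rw [Equiv.symm_apply_eq, he, Equiv.apply_symm_apply]⟩
      trans := fun {X Y Z} ⟨e, he⟩ ⟨f, hf⟩ => ⟨e.trans f, fun g x => by
        simp [he, hf]⟩ }

/-- Isomorphism classes of finite `G`-sets. -/
def GSetClass (G : Type u) [Group G] : Type (u + 1) := Quotient (FinGSet.isoSetoid G)

namespace GSetClass

variable {G : Type u} [Group G]

/-- The isomorphism class of a finite `G`-set. -/
def mk (X : Type u) [MulAction G X] [Finite X] : GSetClass G :=
  Quotient.mk (FinGSet.isoSetoid G) ⟨X⟩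

theorem mk_eq {X Y : Type u} [MulAction G X] [Finite X] [MulAction G Y] [Finite Y]
    (e : X ≃ Y) (he : ∀ (g : G) (x : X), e (g • x) = g • e x) :
    (mk X : GSetClass G) = mk Y :=
  Quotient.sound ⟨e, he⟩

theorem ind {p : GSetClass G → Prop}
    (h : ∀ (X : Type u) [MulAction G X] [Finite X], p (mk X)) (a : GSetClass G) : p a :=
  Quotient.inductionOn a fun X => h X.carrier

/-- Addition is disjoint union. -/
instance : Add (GSetClass G) :=
  ⟨Quotient.map₂ (fun X Y => ⟨X.carrier ⊕ Y.carrier⟩) (by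
    rintro X X' ⟨e, he⟩ Y Y' ⟨f, hf⟩
    refine ⟨Equiv.sumCongr e f, ?_⟩
    rintro g (x | y)
    · exact congrArg Sum.inl (he g x)
    · exact congrArg Sum.inr (hf g y))⟩

/-- Multiplication is Cartesian product, with the diagonal action. -/
instance : Mul (GSetClass G) :=
  ⟨Quotient.map₂ (fun X Y => ⟨X.carrier × Y.carrier⟩) (by
    rintro X X' ⟨e, he⟩ Y Y' ⟨f, hf⟩
    refine ⟨Equiv.prodCongr e f, ?_⟩
    rintro g ⟨x, y⟩
    exact Prod.ext (he g x) (hf g y))⟩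

/-- The empty `G`-set. -/
instance : Zero (GSetClass G) :=
  ⟨Quotient.mk (FinGSet.isoSetoid G)
    (@FinGSet.mk G _ PEmpty
      { smul := fun _ x => x, one_smul := fun _ => rfl, mul_smul := fun _ _ _ => rfl } _)⟩

/-- The one-point `G`-set. -/
instance : One (GSetClass G) :=
  ⟨Quotient.mk (FinGSet.isoSetoid G)
    (@FinGSet.mk G _ PUnit
      { smul := fun _ x => x, one_smul := fun _ => rfl, mul_smul := fun _ _ _ => rfl } _)⟩

theorem mk_add (X Y : Type u) [MulAction G X] [Finite X] [MulAction G Y] [Finite Y] :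
    (mk X + mk Y : GSetClass G) = mk (X ⊕ Y) := rfl

theorem mk_mul (X Y : Type u) [MulAction G X] [Finite X] [MulAction G Y] [Finite Y] :
    (mk X * mk Y : GSetClass G) = mk (X × Y) := rfl

theorem mk_of_isEmpty (X : Type u) [MulAction G X] [Finite X] [IsEmpty X] :
    (mk X : GSetClass G) = 0 :=
  Quotient.sound ⟨Equiv.equivOfIsEmpty X PEmpty, fun _ x => isEmptyElim x⟩

theorem mk_of_unique (X : Type u) [MulAction G X] [Finite X] [Unique X] :
    (mk X : GSetClass G) = 1 :=
  Quotient.sound ⟨Equiv.ofUnique X PUnit, fun _ _ => rfl⟩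

theorem mul_comm' (a b : GSetClass G) : a * b = b * a := by
  induction a using ind with | h X =>
  induction b using ind with | h Y =>
  exact mk_eq (Equiv.prodComm X Y) fun _ _ => rfl

theorem zero_mul' (a : GSetClass G) : 0 * a = 0 := by
  induction a using ind with | h X =>
  refine Quotient.sound ⟨Equiv.pemptyProd X, ?_⟩
  rintro g ⟨x, _⟩
  exact x.elim

theorem one_mul' (a : GSetClass G) : 1 * a = a := by
  induction a using ind with | h X =>
  exact Quotient.sound ⟨Equiv.punitProd X, fun _ _ => rfl⟩

theorem zero_add' (a : GSetClass G) : 0 + a = a := by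
  induction a using ind with | h X =>
  refine Quotient.sound ⟨Equiv.emptySum PEmpty X, ?_⟩
  rintro g (x | x)
  · exact x.elim
  · rfl

theorem add_comm' (a b : GSetClass G) : a + b = b + a := by
  induction a using ind with | h X =>
  induction b using ind with | h Y =>
  refine mk_eq (Equiv.sumComm X Y) ?_
  rintro g (x | x) <;> rfl

theorem add_mul' (a b c : GSetClass G) : (a + b) * c = a * c + b * c := by
  induction a using ind with | h X =>
  induction b using ind with | h Y =>
  induction c using ind with | h Z =>
  refine mk_eq (Equiv.sumProdDistrib X Y Z) ?_
  rintro g ⟨x | x, z⟩ <;> rfl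

instance : CommSemiring (GSetClass G) where
  add_assoc a b c := by
    induction a using ind with | h X =>
    induction b using ind with | h Y =>
    induction c using ind with | h Z =>
    refine mk_eq (Equiv.sumAssoc X Y Z) ?_
    rintro g ((x | x) | x) <;> rfl
  zero_add := zero_add'
  add_zero a := by rw [add_comm', zero_add']
  add_comm := add_comm'
  mul_assoc a b c := by
    induction a using ind with | h X =>
    induction b using ind with | h Y =>
    induction c using ind with | h Z =>
    exact mk_eq (Equiv.prodAssoc X Y Z) fun _ _ => rfl
  one_mul := one_mul'
  mul_one a := by rw [mul_comm', one_mul']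
  mul_comm := mul_comm'
  zero_mul := zero_mul'
  mul_zero a := by rw [mul_comm', zero_mul']
  right_distrib := add_mul'
  left_distrib a b c := by
    rw [mul_comm', add_mul', mul_comm' b, mul_comm' c]
  nsmul := nsmulRec

/-- The number of `K`-fixed points, as a semiring homomorphism on classes of finite `G`-sets. -/
def fixedCard (K : Subgroup G) : GSetClass G →+* ℤ where
  toFun := Quotient.lift (fun X => (Nat.card (MulAction.fixedPoints K X.carrier) : ℤ)) (by
    rintro X Y ⟨e, he⟩
    refine congrArg Nat.cast (Nat.card_congr (e.subtypeEquiv fun x => ?_))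
    refine forall_congr' fun k => ?_
    have h : k • e x = e (k • x) := (he k x).symm
    rw [h, e.apply_eq_iff_eq])
  map_zero' := by
    refine (congrArg Nat.cast ?_).trans Nat.cast_zero
    exact @Nat.card_of_isEmpty _ ⟨fun x => x.1.elim⟩
  map_one' := by
    refine (congrArg Nat.cast ?_).trans Nat.cast_one
    exact @Nat.card_unique _ ⟨⟨PUnit.unit, fun _ => rfl⟩⟩ ⟨fun _ _ => Subtype.ext rfl⟩
  map_add' a b := by
    induction a using ind with | h X =>
    induction b using ind with | h Y =>
    refine (congrArg Nat.cast ?_).trans (Nat.cast_add _ _)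
    rw [← Nat.card_sum]
    refine Nat.card_congr (Equiv.subtypeSum.trans (Equiv.sumCongr ?_ ?_))
    · exact Equiv.subtypeEquivRight fun x => forall_congr' fun k => Sum.inl_injective.eq_iff
    · exact Equiv.subtypeEquivRight fun x => forall_congr' fun k => Sum.inr_injective.eq_iff
  map_mul' a b := by
    induction a using ind with | h X =>
    induction b using ind with | h Y =>
    refine (congrArg Nat.cast ?_).trans (Nat.cast_mul _ _)
    rw [← Nat.card_prod]
    refine Nat.card_congr (Equiv.trans (Equiv.subtypeEquivRight fun x => ?_)
      (Equiv.subtypeProdEquivProd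
        (p := (· ∈ MulAction.fixedPoints K X)) (q := (· ∈ MulAction.fixedPoints K Y))))
    simp only [MulAction.mem_fixedPoints, ← forall_and]
    exact forall_congr' fun k => Prod.ext_iff

end GSetClass

/-- The Burnside ring of `G`: the Grothendieck ring of the semiring of isomorphism classes of
finite `G`-sets under disjoint union and Cartesian product. -/
abbrev BurnsideRing (G : Type u) [Group G] : Type (u + 1) := GrothendieckRing (GSetClass G)

namespace BurnsideRing

/-- The element `[X]` of the Burnside ring. -/
def cls (G : Type u) [Group G] (X : Type u) [MulAction G X] [Finite X] : BurnsideRing G :=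
  GrothendieckRing.of (GSetClass.mk X)

/-- The mark homomorphism `φ_K : B(G) → ℤ`, with `φ_K([X])` the number of `K`-fixed points of `X`. -/
def mark {G : Type u} [Group G] (K : Subgroup G) : BurnsideRing G →+* ℤ :=
  GrothendieckRing.lift (GSetClass.fixedCard K)

variable {G : Type u} [Group G]

theorem mark_cls (K : Subgroup G) (X : Type u) [MulAction G X] [Finite X] :
    mark K (cls G X) = Nat.card (MulAction.fixedPoints K X) :=
  GrothendieckRing.liftAdd_ofAdd (GSetClass.fixedCard K).toAddMonoidHom (GSetClass.mk X)

variable [Finite G]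

/-- The element `[G/H]` of the Burnside ring. -/
def coset (H : Subgroup G) : BurnsideRing G := cls G (G ⧸ H)

end BurnsideRing

/-! ### Partial Burnside rings -/

/-- A collection of `G`: a family of subgroups containing `G` and closed under intersection and
conjugation. -/
structure IsCollection {G : Type u} [Group G] (D : Set (Subgroup G)) : Prop where
  top_mem : ⊤ ∈ D
  inf_mem : ∀ H ∈ D, ∀ K ∈ D, H ⊓ K ∈ D
  conj_mem : ∀ H ∈ D, ∀ g : G, H.map (MulAut.conj g).toMonoidHom ∈ D

namespace BurnsideRing

variable {G : Type u} [Group G] [Finite G]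

/-- The `ℤ`-span of the `[G/H]` with `H ∈ D`. -/
def cosetSpan (D : Set (Subgroup G)) : AddSubgroup (BurnsideRing G) :=
  AddSubgroup.closure {x | ∃ H ∈ D, x = coset H}

/-- If all point stabilizers of `X` lie in `D`, then `[X]` is in the span of the `[G/H]`,
`H ∈ D`. -/
theorem cls_mem_cosetSpan (D : Set (Subgroup G)) (n : ℕ) :
    ∀ (X : Type u) [MulAction G X] [Finite X], Nat.card X = n →
      (∀ x : X, MulAction.stabilizer G x ∈ D) → cls G X ∈ cosetSpan D := by
  induction n using Nat.strong_induction_on with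
  | _ n ih =>
  intro X _ _ hn hD
  by_cases hX : IsEmpty X
  · rw [cls, GSetClass.mk_of_isEmpty, map_zero]
    exact zero_mem _
  rw [not_isEmpty_iff] at hX
  obtain ⟨x⟩ := hX
  classical
  let Y : SubMulAction G X :=
    { carrier := (MulAction.orbit G x)ᶜ
      smul_mem' := fun g y hy h => hy (by
        have := MulAction.mem_orbit_of_mem_orbit g⁻¹ h
        rwa [inv_smul_smul] at this) }
  have hsplit : cls G X = coset (MulAction.stabilizer G x) + cls G Y := by
    have h1 : (GSetClass.mk (G ⧸ MulAction.stabilizer G x) : GSetClass G) =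
        GSetClass.mk (MulAction.orbit G x) := by
      refine GSetClass.mk_eq (MulAction.orbitEquivQuotientStabilizer G x).symm ?_
      intro g q
      induction q using QuotientGroup.induction_on with | H a =>
      apply Subtype.ext
      change ((MulAction.orbitEquivQuotientStabilizer G x).symm ((g * a : G) : G ⧸ _) : X) =
        g • ((MulAction.orbitEquivQuotientStabilizer G x).symm (a : G ⧸ _) : X)
      rw [MulAction.orbitEquivQuotientStabilizer_symm_apply,
        MulAction.orbitEquivQuotientStabilizer_symm_apply, mul_smul]
    have h2 : (GSetClass.mk (MulAction.orbit G x ⊕ Y) : GSetClass G) = GSetClass.mk X := by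
      refine GSetClass.mk_eq (Equiv.Set.sumCompl (MulAction.orbit G x)) ?_
      rintro g (y | y) <;> rfl
    rw [cls, coset, cls, cls, ← map_add, h1, GSetClass.mk_add, h2]
  rw [hsplit]
  refine add_mem (AddSubgroup.subset_closure ⟨_, hD x, rfl⟩) (ih (Nat.card Y) ?_ Y rfl ?_)
  · rw [← hn]
    exact Finite.card_subtype_lt (p := (· ∈ Y)) (x := x)
      fun h => h (MulAction.mem_orbit_self x)
  · intro y
    rw [SubMulAction.stabilizer_of_subMul]
    exact hD y

theorem stabilizer_quotient_mem {D : Set (Subgroup G)} (hD : IsCollection D)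
    {H : Subgroup G} (hH : H ∈ D) (q : G ⧸ H) : MulAction.stabilizer G q ∈ D := by
  induction q using QuotientGroup.induction_on with | H a =>
  have h : MulAction.stabilizer G (a : G ⧸ H) = H.map (MulAut.conj a).toMonoidHom := by
    have e : (a : G ⧸ H) = a • ((1 : G) : G ⧸ H) :=
      congrArg (QuotientGroup.mk (s := H)) (mul_one a).symm
    rw [e, MulAction.stabilizer_smul_eq_stabilizer_map_conj, MulAction.stabilizer_quotient]
  rw [h]
  exact hD.conj_mem H hH a

/-- The partial Burnside ring `B(G, D)` relative to a collection `D`: the subring of `B(G)` which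
as an additive group is spanned by the `[G/H]` with `H ∈ D`. -/
def partialRing (D : Set (Subgroup G)) (hD : IsCollection D) : Subring (BurnsideRing G) :=
  { cosetSpan D with
    one_mem' := by
      refine AddSubgroup.subset_closure ⟨⊤, hD.top_mem, ?_⟩
      have : Subsingleton (G ⧸ (⊤ : Subgroup G)) := QuotientGroup.subsingleton_quotient_top
      have : Unique (G ⧸ (⊤ : Subgroup G)) :=
        ⟨⟨((1 : G) : G ⧸ _)⟩, fun _ => Subsingleton.elim _ _⟩
      rw [coset, cls, GSetClass.mk_of_unique, map_one]
    mul_mem' := by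
      intro x y hx hy
      change x * y ∈ cosetSpan D
      change x ∈ cosetSpan D at hx
      change y ∈ cosetSpan D at hy
      induction hx using AddSubgroup.closure_induction with
      | zero => rw [zero_mul]; exact zero_mem _
      | add a b _ _ ha hb => rw [add_mul]; exact add_mem ha hb
      | neg a _ ha => rw [neg_mul]; exact neg_mem ha
      | mem a ha =>
        obtain ⟨H, hH, rfl⟩ := ha
        induction hy using AddSubgroup.closure_induction with
        | zero => rw [mul_zero]; exact zero_mem _
        | add a b _ _ ha hb => rw [mul_add]; exact add_mem ha hb
        | neg a _ ha => rw [mul_neg]; exact neg_mem ha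
        | mem b hb =>
          obtain ⟨K, hK, rfl⟩ := hb
          have h : coset H * coset K = cls G ((G ⧸ H) × (G ⧸ K)) := by
            rw [coset, coset, cls, cls, cls, ← map_mul, GSetClass.mk_mul]
          rw [h]
          refine cls_mem_cosetSpan D _ _ rfl ?_
          rintro ⟨p, q⟩
          have hs : MulAction.stabilizer G (p, q) =
              MulAction.stabilizer G p ⊓ MulAction.stabilizer G q := by
            ext g
            exact Prod.ext_iff
          rw [hs]
          exact hD.inf_mem _ (stabilizer_quotient_mem hD hH p) _
            (stabilizer_quotient_mem hD hK q) }

end BurnsideRing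

/-- The set of all normal subgroups of `G`. -/
def Nsub (G : Type u) [Group G] : Set (Subgroup G) := {N | N.Normal}

theorem isCollection_Nsub (G : Type u) [Group G] : IsCollection (Nsub G) where
  top_mem := inferInstanceAs (⊤ : Subgroup G).Normal
  inf_mem H hH K hK := by
    have : H.Normal := hH
    have : K.Normal := hK
    exact inferInstanceAs (H ⊓ K).Normal
  conj_mem H hH g := hH.map _ (MulAut.conj g).surjective

/-! ### Seminilpotent groups and the Frobenius–Wielandt homomorphism -/

/-- A finite group `G` is `p ^ a`-seminilpotent if, for every subgroup `K` whose index is divisible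
by `p ^ a`, there is a normal subgroup of index `p ^ a` containing `K`, and the number of such
normal subgroups is congruent to `1` modulo `p`. -/
def IsSeminilpotent (p a : ℕ) (G : Type u) [Group G] : Prop :=
  ∀ K : Subgroup G, p ^ a ∣ K.index →
    (∃ N : Subgroup G, N.Normal ∧ K ≤ N ∧ N.index = p ^ a) ∧
      Nat.card {N : Subgroup G // N.Normal ∧ K ≤ N ∧ N.index = p ^ a} ≡ 1 [MOD p]

/-- `α : B(C) → B(G)`, with `C` cyclic of order `|G|`, is the Frobenius–Wielandt homomorphism:
`φ_K(α(x)) = φ_L(x)` for every subgroup `K` of `G`, where `L` is the subgroup of `C` of order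
`|K|`. -/
def IsFrobeniusWielandt {G : Type u} [Group G] {C : Type v} [Group C]
    (α : BurnsideRing C →+* BurnsideRing G) : Prop :=
  ∀ (K : Subgroup G) (L : Subgroup C), Nat.card L = Nat.card K →
    ∀ x : BurnsideRing C, BurnsideRing.mark K (α x) = BurnsideRing.mark L x

/-- The element `u_N = 1 - [G/N]` of the Burnside ring. -/
def uElem {G : Type u} [Group G] [Finite G] (N : Subgroup G) : BurnsideRing G :=
  1 - BurnsideRing.coset N

end

/-! ### Subgroups of finite cyclic groups -/

namespace IsCyclic

variable {C : Type v} [Group C] [IsCyclic C] [Finite C]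

/-! An element of a Burnside ring is determined by its marks (`ext_mark`), so every identity,
including the uniqueness of `α`, can be checked on marks.

Existence of `α` rests on the `G`-set of `d`-element subsets of `G` under left translation. Its
`K`-fixed points are the unions of right cosets of `K` with `d` elements in all, and their number
depends only on `d`, `|K|` and `|G : K|`. Hence this class in `B(G)` has the marks prescribed by the
corresponding class in `B(C)` (`mark_subsetsOfCard_eq`). In the cyclic group `C` these classes are
unitriangular in the `[C/L]`, so they generate `B(C)` additively, and every element of `B(C)` has a
partner in `B(G)` (`mem_matchable`).

The marks of a unit are `±1`. For cyclic `C` of even order, with `M` of index 2, this leaves only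
the units `±1` and `±u_M` (`units_eq_closure_of_isCyclic`). The mark of `α(u_M)` at `K` is `-1`
exactly when `|K|` divides `n/2`, that is, when `|G : K|` is even. The mark at `K` of the product of
all `u_N` is `-1` to the number of index-2 subgroups containing `K`. Seminilpotency makes this
number odd when `|G : K|` is even, and it is zero otherwise (`mark_prod_uElem`). So `α(u_M)` is that
product, which visibly lies in the span of the `[G/N]` with `N` normal. -/

theorem mem_subgroup_iff_pow_card_eq_one (K : Subgroup C) (x : C) :
    x ∈ K ↔ x ^ Nat.card K = 1 := by
  classical
  have := Fintype.ofFinite C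
  have hsub : (K : Set C).toFinset ⊆ Finset.univ.filter fun a : C => a ^ Nat.card K = 1 := by
    intro a ha
    have ha' : a ∈ K := by simpa using ha
    rw [Finset.mem_filter_univ]
    exact congrArg Subtype.val (pow_card_eq_one' (x := (⟨a, ha'⟩ : K)))
  -- In a cyclic group `a ^ d = 1` has at most `d` solutions; for `d = |K|` the elements of `K`
  -- already account for all of them.
  have heq := Finset.eq_of_subset_of_card_le hsub (by
    refine (IsCyclic.card_pow_eq_one_le Nat.card_pos).trans (le_of_eq ?_)
    rw [Set.toFinset_card, ← Nat.card_eq_fintype_card]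
    rfl)
  have := Finset.ext_iff.1 heq x
  simpa using this

theorem subgroup_le_iff_card_dvd (H K : Subgroup C) : H ≤ K ↔ Nat.card H ∣ Nat.card K := by
  refine ⟨Subgroup.card_dvd_of_le, fun h x hx => ?_⟩
  rw [mem_subgroup_iff_pow_card_eq_one] at hx ⊢
  obtain ⟨c, hc⟩ := h
  rw [hc, pow_mul, hx, one_pow]

theorem subgroup_eq_of_card_eq {H K : Subgroup C} (h : Nat.card H = Nat.card K) : H = K :=
  le_antisymm ((subgroup_le_iff_card_dvd H K).2 h.dvd) ((subgroup_le_iff_card_dvd K H).2 h.symm.dvd)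

theorem exists_subgroup_card_eq {d : ℕ} (hd : d ∣ Nat.card C) :
    ∃ L : Subgroup C, Nat.card L = d := by
  obtain ⟨g, hg⟩ := IsCyclic.exists_ofOrder_eq_natCard (α := C)
  obtain ⟨m, hm⟩ := hd
  have hpos : 0 < Nat.card C := Nat.card_pos
  have hm0 : m ≠ 0 := by rintro rfl; omega
  refine ⟨Subgroup.zpowers (g ^ m), ?_⟩
  rw [Nat.card_zpowers, orderOf_pow_of_dvd hm0 (by rw [hg, hm]; exact dvd_mul_left _ _), hg, hm,
    Nat.mul_div_cancel _ (Nat.pos_of_ne_zero hm0)]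

end IsCyclic

/-! ### Marks -/

namespace BurnsideRing

section Marks

variable {G : Type u} [Group G]

theorem cls_sum (X Y : Type u) [MulAction G X] [Finite X] [MulAction G Y] [Finite Y] :
    cls G (X ⊕ Y) = cls G X + cls G Y := by
  rw [cls, cls, cls, ← map_add, GSetClass.mk_add]

theorem exists_eq_cls_sub_cls (x : BurnsideRing G) :
    ∃ (X Y : FinGSet G), x = cls G X.carrier - cls G Y.carrier := by
  obtain ⟨a, b, rfl⟩ := GrothendieckRing.exists_sub x
  induction a using GSetClass.ind with | h X =>
  induction b using GSetClass.ind with | h Y =>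
  exact ⟨⟨X⟩, ⟨Y⟩, rfl⟩

/-- The complement of an orbit, as a `G`-set. -/
def orbitCompl {X : Type u} [MulAction G X] (x : X) : SubMulAction G X where
  carrier := (MulAction.orbit G x)ᶜ
  smul_mem' g y hy h := hy (by
    have := MulAction.mem_orbit_of_mem_orbit g⁻¹ h
    rwa [inv_smul_smul] at this)

theorem card_orbitCompl_lt (X : Type u) [MulAction G X] [Finite X] (x : X) :
    Nat.card (orbitCompl (G := G) x) < Nat.card X :=
  Finite.card_subtype_lt (p := (· ∈ orbitCompl (G := G) x)) (x := x)
    fun h => h (MulAction.mem_orbit_self x)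

theorem mem_fixedPoints_iff_le_stabilizer {X : Type u} [MulAction G X] (K : Subgroup G) (x : X) :
    x ∈ MulAction.fixedPoints K X ↔ K ≤ MulAction.stabilizer G x :=
  ⟨fun h k hk => h ⟨k, hk⟩, fun h k => h k.2⟩

theorem mark_cls_ne_zero_iff (K : Subgroup G) (X : Type u) [MulAction G X] [Finite X] :
    mark K (cls G X) ≠ 0 ↔ ∃ x : X, K ≤ MulAction.stabilizer G x := by
  rw [mark_cls, Nat.cast_ne_zero, ← Nat.pos_iff_ne_zero, Finite.card_pos_iff, nonempty_subtype]
  simp only [mem_fixedPoints_iff_le_stabilizer]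

open scoped Classical in
theorem mark_cls_of_stabilizer_eq {X : Type u} [MulAction G X] [Finite X] {N : Subgroup G}
    (hX : ∀ x : X, MulAction.stabilizer G x = N) (K : Subgroup G) :
    mark K (cls G X) = if K ≤ N then (Nat.card X : ℤ) else 0 := by
  have hfix : ∀ x : X, x ∈ MulAction.fixedPoints K X ↔ K ≤ N := fun x => by
    rw [mem_fixedPoints_iff_le_stabilizer, hX]
  rw [mark_cls]
  split_ifs with h
  · rw [Set.eq_univ_of_forall fun x => (hfix x).2 h, Nat.card_univ]
  · rw [Set.eq_empty_of_forall_notMem fun x hx => h ((hfix x).1 hx)]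
    simp

variable [Finite G]

theorem cls_eq_coset_add (X : Type u) [MulAction G X] [Finite X] (x : X) :
    cls G X = coset (MulAction.stabilizer G x) + cls G (orbitCompl (G := G) x) := by
  classical
  have h1 : (GSetClass.mk (G ⧸ MulAction.stabilizer G x) : GSetClass G) =
      GSetClass.mk (MulAction.orbit G x) := by
    refine GSetClass.mk_eq (MulAction.orbitEquivQuotientStabilizer G x).symm ?_
    intro g q
    induction q using QuotientGroup.induction_on with | H a =>
    apply Subtype.ext
    change ((MulAction.orbitEquivQuotientStabilizer G x).symm ((g * a : G) : G ⧸ _) : X) =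
      g • ((MulAction.orbitEquivQuotientStabilizer G x).symm (a : G ⧸ _) : X)
    rw [MulAction.orbitEquivQuotientStabilizer_symm_apply,
      MulAction.orbitEquivQuotientStabilizer_symm_apply, mul_smul]
  have h2 : (GSetClass.mk (MulAction.orbit G x ⊕ orbitCompl (G := G) x) : GSetClass G) =
      GSetClass.mk X := by
    refine GSetClass.mk_eq (Equiv.Set.sumCompl (MulAction.orbit G x)) ?_
    rintro g (y | y) <;> rfl
  rw [cls, coset, cls, cls, ← map_add, h1, GSetClass.mk_add, h2]

/-- One orbit is removed at a time. A mark at `K` is nonzero iff `K` lies in a point stabilizer, so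
a stabilizer of maximal order in `X` lies in one of `Y`, which in turn lies in one of `X`.
Maximality makes the first two equal, so `X` and `Y` share an orbit type, and the complements again
have equal marks. -/
theorem cls_eq_of_mark_eq (n : ℕ) : ∀ (X Y : Type u) [MulAction G X] [Finite X] [MulAction G Y]
    [Finite Y], Nat.card X = n → (∀ K : Subgroup G, mark K (cls G X) = mark K (cls G Y)) →
    cls G X = cls G Y := by
  induction n using Nat.strong_induction_on with
  | _ n ih =>
  intro X Y _ _ _ _ hn h
  by_cases hX : IsEmpty X
  · have hY : IsEmpty Y := by
      by_contra hY
      rw [not_isEmpty_iff] at hY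
      obtain ⟨y⟩ := hY
      have h0 := (mark_cls_ne_zero_iff (⊥ : Subgroup G) Y).2 ⟨y, bot_le⟩
      rw [← h, mark_cls_ne_zero_iff] at h0
      exact hX.elim h0.choose
    rw [cls, cls, GSetClass.mk_of_isEmpty, GSetClass.mk_of_isEmpty]
  rw [not_isEmpty_iff] at hX
  obtain ⟨x, hx⟩ := Finite.exists_max fun x : X => Nat.card (MulAction.stabilizer G x)
  obtain ⟨y, hy⟩ := (mark_cls_ne_zero_iff (MulAction.stabilizer G x) Y).1
    (h _ ▸ (mark_cls_ne_zero_iff _ X).2 ⟨x, le_rfl⟩)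
  obtain ⟨z, hz⟩ := (mark_cls_ne_zero_iff (MulAction.stabilizer G y) X).1
    (h _ ▸ (mark_cls_ne_zero_iff _ Y).2 ⟨y, le_rfl⟩)
  have hxy : MulAction.stabilizer G x = MulAction.stabilizer G y :=
    Subgroup.eq_of_le_of_card_ge hy ((Subgroup.card_le_of_le hz).trans (hx z))
  rw [cls_eq_coset_add X x, cls_eq_coset_add Y y, ← hxy]
  congr 1
  refine ih _ (hn ▸ card_orbitCompl_lt X x) _ _ rfl fun K => ?_
  have hK := h K
  rw [cls_eq_coset_add X x, cls_eq_coset_add Y y, ← hxy, map_add, map_add] at hK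
  exact add_left_cancel hK

/-- An element of the Burnside ring is determined by its marks. -/
theorem ext_mark {x y : BurnsideRing G} (h : ∀ K : Subgroup G, mark K x = mark K y) : x = y := by
  obtain ⟨X, Y, rfl⟩ := exists_eq_cls_sub_cls x
  obtain ⟨Z, W, rfl⟩ := exists_eq_cls_sub_cls y
  -- Moving the negative terms across turns the claim into one about two actual `G`-sets.
  rw [sub_eq_sub_iff_add_eq_add, ← cls_sum, ← cls_sum]
  refine cls_eq_of_mark_eq _ _ _ rfl fun K => ?_
  rw [cls_sum, cls_sum, map_add, map_add, ← sub_eq_sub_iff_add_eq_add, ← map_sub, ← map_sub, h]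

open scoped Classical in
theorem mark_coset_of_normal (K N : Subgroup G) [hN : N.Normal] :
    mark K (coset N) = if K ≤ N then (N.index : ℤ) else 0 := by
  refine mark_cls_of_stabilizer_eq (fun q => ?_) K
  induction q using QuotientGroup.induction_on with | H a =>
  have e : (a : G ⧸ N) = a • ((1 : G) : G ⧸ N) :=
    congrArg (QuotientGroup.mk (s := N)) (mul_one a).symm
  rw [e, MulAction.stabilizer_smul_eq_stabilizer_map_conj, MulAction.stabilizer_quotient]
  ext g
  simp only [Subgroup.mem_map, MulEquiv.coe_toMonoidHom, MulAut.conj_apply]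
  refine ⟨?_, fun hg => ⟨a⁻¹ * g * a, ?_, by group⟩⟩
  · rintro ⟨n, hn, rfl⟩
    exact hN.conj_mem n hn a
  · simpa using hN.conj_mem g hg a⁻¹

theorem mem_cosetSpan_univ (x : BurnsideRing G) : x ∈ cosetSpan (Set.univ : Set (Subgroup G)) := by
  obtain ⟨X, Y, rfl⟩ := exists_eq_cls_sub_cls x
  exact sub_mem (cls_mem_cosetSpan _ _ _ rfl fun _ => Set.mem_univ _)
    (cls_mem_cosetSpan _ _ _ rfl fun _ => Set.mem_univ _)

theorem exists_eq_sum_of_mem_cosetSpan [Fintype (Subgroup G)] {D : Set (Subgroup G)}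
    {x : BurnsideRing G} (hx : x ∈ cosetSpan D) :
    ∃ a : Subgroup G → ℤ, (∀ H, a H ≠ 0 → H ∈ D) ∧ x = ∑ H, a H • coset H := by
  classical
  induction hx using AddSubgroup.closure_induction with
  | zero => exact ⟨0, by simp, by simp⟩
  | mem a ha =>
    obtain ⟨H, hH, rfl⟩ := ha
    refine ⟨Pi.single H 1, fun K hK => ?_, ?_⟩
    · by_cases h : K = H
      · exact h ▸ hH
      · simp [h] at hK
    · rw [Finset.sum_eq_single H] <;> simp +contextual
  | add x y _ _ hx hy =>
    obtain ⟨a, ha, rfl⟩ := hx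
    obtain ⟨b, hb, rfl⟩ := hy
    refine ⟨a + b, fun H hH => ?_, by simp [add_smul, Finset.sum_add_distrib]⟩
    by_cases h : a H = 0
    · exact hb H fun h' => hH (by simp [h, h'])
    · exact ha H h
  | neg x _ hx =>
    obtain ⟨a, ha, rfl⟩ := hx
    exact ⟨-a, fun H hH => ha H (by simpa using hH), by simp⟩

end Marks

/-! ### Subsets of a given size -/

section Subsets

open scoped Pointwise

/-- The `G`-set of subsets of `G` with `d` elements. -/
def subsetsOfCard (G : Type u) [Group G] (d : ℕ) : SubMulAction G (Set G) where
  carrier := {s | s.ncard = d}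
  smul_mem' g s hs := (Set.ncard_smul_set g s).trans hs

variable {G : Type u} [Group G]

/-- `G ⧸ K` consists of left cosets, whereas the orbits of left translation by `K` are right cosets;
the inversion passes from one to the other. -/
theorem ncard_preimage_inv_mk (K : Subgroup G) (T : Set (G ⧸ K)) :
    ((fun g : G => ((g⁻¹ : G) : G ⧸ K)) ⁻¹' T).ncard = Nat.card K * T.ncard := by
  have h : (fun g : G => ((g⁻¹ : G) : G ⧸ K)) ⁻¹' T = ((QuotientGroup.mk : G → G ⧸ K) ⁻¹' T)⁻¹ :=
    rfl
  rw [h, Set.ncard_inv, ← Nat.card_coe_set_eq, ← Nat.card_coe_set_eq, ← Nat.card_prod,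
    Nat.card_congr (QuotientGroup.preimageMkEquivSubgroupProdSet K T)]

theorem eq_preimage_image_of_smul_eq {K : Subgroup G} {s : Set G}
    (hs : ∀ k ∈ K, k • s = s) :
    (fun g : G => ((g⁻¹ : G) : G ⧸ K)) ⁻¹' ((fun g : G => ((g⁻¹ : G) : G ⧸ K)) '' s) = s := by
  refine Set.Subset.antisymm ?_ (Set.subset_preimage_image _ _)
  rintro g ⟨h, hh, hgh⟩
  have hk : g * h⁻¹ ∈ K := by
    have := QuotientGroup.eq.1 hgh.symm
    simpa using this
  rw [← hs _ hk]
  exact ⟨h, hh, by simp⟩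

theorem smul_preimage_inv_mk {K : Subgroup G} (T : Set (G ⧸ K)) {k : G} (hk : k ∈ K) :
    k • ((fun g : G => ((g⁻¹ : G) : G ⧸ K)) ⁻¹' T) = (fun g : G => ((g⁻¹ : G) : G ⧸ K)) ⁻¹' T := by
  ext g
  rw [Set.mem_smul_set_iff_inv_smul_mem, Set.mem_preimage, Set.mem_preimage]
  have : (((k⁻¹ • g)⁻¹ : G) : G ⧸ K) = ((g⁻¹ : G) : G ⧸ K) := by
    rw [QuotientGroup.eq]
    simpa using hk
  rw [this]

/-- The `K`-stable subsets of `G` with `d` elements are the unions of right cosets of `K`. -/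
def fixedPointsSubsetsEquiv (K : Subgroup G) (d : ℕ) :
    MulAction.fixedPoints K (subsetsOfCard G d) ≃
      {T : Set (G ⧸ K) // Nat.card K * T.ncard = d} where
  toFun s := ⟨(fun g : G => ((g⁻¹ : G) : G ⧸ K)) '' s.1.1, by
    rw [← ncard_preimage_inv_mk, eq_preimage_image_of_smul_eq fun k hk =>
      congrArg Subtype.val (s.2 ⟨k, hk⟩)]
    exact s.1.2⟩
  invFun T := ⟨⟨(fun g : G => ((g⁻¹ : G) : G ⧸ K)) ⁻¹' T.1,
      (ncard_preimage_inv_mk K T.1).trans T.2⟩,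
    fun k => Subtype.ext (smul_preimage_inv_mk T.1 k.2)⟩
  left_inv s := Subtype.ext <| Subtype.ext <| eq_preimage_image_of_smul_eq fun k hk =>
      congrArg Subtype.val (s.2 ⟨k, hk⟩)
  right_inv T := Subtype.ext <| Set.image_preimage_eq _ <|
    QuotientGroup.mk_surjective.comp inv_surjective

/-- A subset is fixed by its own stabilizer, hence is a union of right cosets of it. -/
theorem card_stabilizer_dvd_of_mem_subsetsOfCard {d : ℕ} (s : subsetsOfCard G d) :
    Nat.card (MulAction.stabilizer G s) ∣ d := by
  have hs : s ∈ MulAction.fixedPoints (MulAction.stabilizer G s) (subsetsOfCard G d) :=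
    fun k => k.2
  have := (fixedPointsSubsetsEquiv _ d ⟨s, hs⟩).2
  exact ⟨_, this.symm⟩

variable [Finite G]

theorem mark_subsetsOfCard (K : Subgroup G) (d : ℕ) :
    mark K (cls G (subsetsOfCard G d)) =
      Nat.card {T : Set (G ⧸ K) // Nat.card K * T.ncard = d} := by
  rw [mark_cls, Nat.card_congr (fixedPointsSubsetsEquiv K d)]

/-- This is the link between `C` and `G`: a bijection of the coset spaces, with no compatibility
with the actions, suffices to match the fixed points. -/
theorem mark_subsetsOfCard_eq {C : Type v} [Group C] [Finite C] (h : Nat.card C = Nat.card G)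
    (K : Subgroup G) (L : Subgroup C) (hKL : Nat.card L = Nat.card K) (d : ℕ) :
    mark K (cls G (subsetsOfCard G d)) = mark L (cls C (subsetsOfCard C d)) := by
  have hidx : Nat.card (G ⧸ K) = Nat.card (C ⧸ L) := by
    have h1 := K.card_eq_card_quotient_mul_card_subgroup
    have h2 := L.card_eq_card_quotient_mul_card_subgroup
    rw [h, hKL, h1] at h2
    exact Nat.eq_of_mul_eq_mul_right Nat.card_pos h2
  obtain ⟨e⟩ := Finite.card_eq.1 hidx
  rw [mark_subsetsOfCard, mark_subsetsOfCard, hKL]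
  refine congrArg Nat.cast (Nat.card_congr ((Equiv.Set.congr e).subtypeEquiv fun T => ?_))
  have : (Equiv.Set.congr e T).ncard = T.ncard := Set.ncard_image_of_injective T e.injective
  rw [this]

/-- For `d = |K|` the `K`-stable subsets are the single right cosets of `K`. -/
theorem mark_subsetsOfCard_card (K : Subgroup G) :
    mark K (cls G (subsetsOfCard G (Nat.card K))) = K.index := by
  rw [mark_subsetsOfCard, Subgroup.index]
  congr 1
  refine (Nat.card_congr (Equiv.ofBijective (fun q => ⟨{q}, by simp⟩) ⟨?_, ?_⟩)).symm
  · intro p q h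
    simpa using h
  · rintro ⟨T, hT⟩
    have h1 : T.ncard = 1 := by
      have := Nat.card_pos (α := K)
      exact Nat.eq_of_mul_eq_mul_left this (by rw [hT, mul_one])
    obtain ⟨q, rfl⟩ := Set.ncard_eq_one.1 h1
    exact ⟨q, rfl⟩

end Subsets

end BurnsideRing

namespace BurnsideRing

/-! ### The Frobenius–Wielandt homomorphism -/

section FrobeniusWielandt

open scoped Pointwise

variable (G : Type u) [Group G] (C : Type v) [Group C]

/-- The subgroup of those `x ∈ B(C)` whose marks are the marks of an element of `B(G)`. -/
def matchable : AddSubgroup (BurnsideRing C) where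
  carrier := {x | ∃ y : BurnsideRing G, ∀ (K : Subgroup G) (L : Subgroup C),
    Nat.card L = Nat.card K → mark K y = mark L x}
  zero_mem' := ⟨0, fun _ _ _ => by rw [map_zero, map_zero]⟩
  add_mem' := by
    rintro a b ⟨x, hx⟩ ⟨y, hy⟩
    exact ⟨x + y, fun K L h => by rw [map_add, map_add, hx K L h, hy K L h]⟩
  neg_mem' := by
    rintro a ⟨x, hx⟩
    exact ⟨-x, fun K L h => by rw [map_neg, map_neg, hx K L h]⟩

variable {G C} [Finite G] [Finite C] [IsCyclic C]

/-- The class of the `|L|`-element subsets of `C` is `[C/L]` plus a combination of `[C/H]` with `H <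
L`. The whole class is matchable, and so are the lower terms by induction. -/
theorem coset_mem_matchable (hC : Nat.card C = Nat.card G) (n : ℕ) :
    ∀ L : Subgroup C, Nat.card L = n → coset L ∈ matchable G C := by
  classical
  let _ : CommGroup C := IsCyclic.commGroup
  have := Fintype.ofFinite (Subgroup C)
  induction n using Nat.strong_induction_on with
  | _ n ih =>
  intro L hL
  obtain ⟨a, haD, ha⟩ := exists_eq_sum_of_mem_cosetSpan
    (cls_mem_cosetSpan {H : Subgroup C | Nat.card H ∣ Nat.card L} _
      (subsetsOfCard C (Nat.card L)) rfl card_stabilizer_dvd_of_mem_subsetsOfCard)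
  have haL : ∀ H, a H ≠ 0 → H ≤ L := fun H hH =>
    (IsCyclic.subgroup_le_iff_card_dvd H L).2 (haD H hH)
  -- In the mark at `L` only the term `H = L` survives, since the others would need `L ≤ H ≤ L`.
  -- Both sides are then multiples of `|C : L|`, with factors `1` and `a L`.
  have ha1 : a L = 1 := by
    have h := congrArg (mark L) ha
    rw [mark_subsetsOfCard_card, map_sum, Finset.sum_eq_single L] at h
    · rw [map_zsmul, mark_coset_of_normal, if_pos le_rfl, smul_eq_mul] at h
      have h0 : (L.index : ℤ) ≠ 0 := Nat.cast_ne_zero.2 L.index_ne_zero_of_finite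
      exact mul_right_cancel₀ h0 (by rw [← h, one_mul])
    · intro H _ hH
      rw [map_zsmul, mark_coset_of_normal, smul_eq_mul]
      split_ifs with hLH
      · by_cases h0 : a H = 0
        · rw [h0, zero_mul]
        · exact absurd (le_antisymm (haL H h0) hLH) hH
      · rw [mul_zero]
    · simp
  have hsub : cls C (subsetsOfCard C (Nat.card L)) ∈ matchable G C :=
    ⟨cls G (subsetsOfCard G (Nat.card L)), fun K M h => mark_subsetsOfCard_eq hC K M h _⟩
  rw [← Finset.add_sum_erase _ _ (Finset.mem_univ L), ha1, one_smul] at ha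
  rw [← add_sub_cancel_right (coset L) (∑ H ∈ Finset.univ.erase L, a H • coset H), ← ha]
  refine sub_mem hsub (sum_mem fun H hH => ?_)
  by_cases h0 : a H = 0
  · rw [h0, zero_smul]
    exact zero_mem _
  · refine zsmul_mem (ih (Nat.card H) ?_ H rfl) _
    rw [← hL]
    refine lt_of_le_of_ne (Subgroup.card_le_of_le (haL H h0)) fun h => ?_
    exact (Finset.ne_of_mem_erase hH) (IsCyclic.subgroup_eq_of_card_eq h)

theorem mem_matchable (hC : Nat.card C = Nat.card G) (x : BurnsideRing C) :
    x ∈ matchable G C := by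
  refine (AddSubgroup.closure_le _).2 ?_ (mem_cosetSpan_univ x)
  rintro _ ⟨H, _, rfl⟩
  exact coset_mem_matchable hC _ H rfl

theorem eq_of_isFrobeniusWielandt (hC : Nat.card C = Nat.card G)
    {α β : BurnsideRing C →+* BurnsideRing G}
    (hα : IsFrobeniusWielandt α) (hβ : IsFrobeniusWielandt β) : β = α := by
  refine RingHom.ext fun x => ext_mark fun K => ?_
  obtain ⟨L, hL⟩ := IsCyclic.exists_subgroup_card_eq (C := C) (hC ▸ K.card_subgroup_dvd_card)
  rw [hα K L hL, hβ K L hL]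

theorem exists_isFrobeniusWielandt (hC : Nat.card C = Nat.card G) :
    ∃ α : BurnsideRing C →+* BurnsideRing G, IsFrobeniusWielandt α := by
  choose f hf using mem_matchable (G := G) (C := C) hC
  -- The values of `f` are arbitrary choices, but marks force them, because each order `|K|` is
  -- attained by a subgroup of `C`. The ring axioms for `f` follow.
  have key : ∀ (x : BurnsideRing C) (y : BurnsideRing G),
      (∀ (K : Subgroup G) (L : Subgroup C), Nat.card L = Nat.card K → mark K y = mark L x) →
      f x = y := fun x y h => ext_mark fun K => by
    obtain ⟨L, hL⟩ := IsCyclic.exists_subgroup_card_eq (C := C) (hC ▸ K.card_subgroup_dvd_card)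
    rw [hf x K L hL, h K L hL]
  exact ⟨{
    toFun := f
    map_one' := key _ _ fun K L _ => by rw [map_one, map_one]
    map_zero' := key _ _ fun K L _ => by rw [map_zero, map_zero]
    map_mul' := fun x y => key _ _ fun K L h => by rw [map_mul, map_mul, hf x K L h, hf y K L h]
    map_add' := fun x y => key _ _ fun K L h => by rw [map_add, map_add, hf x K L h, hf y K L h] },
    fun K L h x => hf x K L h⟩

end FrobeniusWielandt

/-! ### Units -/

section Units

theorem mark_unit_eq_one_or_neg_one {G : Type u} [Group G] (x : (BurnsideRing G)ˣ)
    (K : Subgroup G) : mark K (x : BurnsideRing G) = 1 ∨ mark K (x : BurnsideRing G) = -1 :=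
  Int.isUnit_iff.1 (x.isUnit.map (mark K))

/-- A unit of the Burnside ring of a finite abelian group is `1` if its marks at the subgroups of
index at most `2` are all `1`. -/
theorem unit_eq_one_of_mark_eq_one {A : Type u} [CommGroup A] [Finite A] (x : (BurnsideRing A)ˣ)
    (h1 : mark ⊤ (x : BurnsideRing A) = 1)
    (h2 : ∀ M : Subgroup A, M.index = 2 → mark M (x : BurnsideRing A) = 1) : x = 1 := by
  classical
  have := Fintype.ofFinite (Subgroup A)
  obtain ⟨a, -, ha⟩ := exists_eq_sum_of_mem_cosetSpan (mem_cosetSpan_univ ((x : BurnsideRing A) - 1))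
  have ha0 : ∀ H, a H = 0 := by
    by_contra! hne
    obtain ⟨H₀, hH₀⟩ := hne
    -- At a maximal `H` in the support of `x - 1`, the mark of `x - 1` is `a H * H.index`, which is
    -- nonzero. It must then be `-2`, so the index of `H` divides 2, where the hypotheses apply.
    obtain ⟨H, -, hH⟩ := (Set.toFinite {H : Subgroup A | a H ≠ 0}).exists_le_maximal hH₀
    have hm := congrArg (mark H) ha
    rw [map_sub, map_one, map_sum, Finset.sum_eq_single H] at hm
    · rw [map_zsmul, mark_coset_of_normal, if_pos le_rfl, smul_eq_mul] at hm
      have hne : a H * (H.index : ℤ) ≠ 0 :=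
        mul_ne_zero hH.prop (Nat.cast_ne_zero.2 H.index_ne_zero_of_finite)
      rcases mark_unit_eq_one_or_neg_one x H with h | h
      · exact hne (by rw [← hm, h, sub_self])
      · have hdvd : H.index ∣ 2 := by
          have : (H.index : ℤ) ∣ 2 := ⟨-a H, by rw [h] at hm; linarith⟩
          exact_mod_cast this
        rcases (Nat.dvd_prime Nat.prime_two).1 hdvd with hi | hi
        · rw [Subgroup.index_eq_one] at hi
          rw [hi, h1] at h
          norm_num at h
        · rw [h2 H hi] at h
          norm_num at h
    · intro K _ hK
      rw [map_zsmul, mark_coset_of_normal, smul_eq_mul]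
      split_ifs with hHK
      · by_cases h0 : a K = 0
        · rw [h0, zero_mul]
        · exact absurd (le_antisymm (hH.2 h0 hHK) hHK) hK
      · rw [mul_zero]
    · simp
  refine Units.ext (sub_eq_zero.1 (ha.trans ?_))
  exact Finset.sum_eq_zero fun H _ => by rw [ha0, zero_smul]

variable {G : Type u} [Group G] [Finite G]

open scoped Classical in
theorem mark_uElem {N : Subgroup G} (hN : N.index = 2) (K : Subgroup G) :
    mark K (uElem N) = if K ≤ N then -1 else 1 := by
  have : N.Normal := Subgroup.normal_of_index_eq_two hN
  rw [uElem, map_sub, map_one, mark_coset_of_normal, hN]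
  split_ifs <;> norm_num

theorem uElem_mul_self {N : Subgroup G} (hN : N.index = 2) : uElem N * uElem N = 1 := by
  classical
  refine ext_mark fun K => ?_
  rw [map_mul, map_one, mark_uElem hN]
  split_ifs <;> norm_num

/-- The unit `u_N` for a subgroup `N` of index `2`. -/
noncomputable def uUnit (N : Subgroup G) (hN : N.index = 2) : (BurnsideRing G)ˣ :=
  ⟨uElem N, uElem N, uElem_mul_self hN, uElem_mul_self hN⟩

theorem uElem_mem_partialRing {N : Subgroup G} (hN : N.index = 2) :
    uElem N ∈ partialRing (Nsub G) (isCollection_Nsub G) :=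
  sub_mem (one_mem _) (AddSubgroup.subset_closure
    ⟨N, Subgroup.normal_of_index_eq_two hN, rfl⟩)

/-- The units of the Burnside ring of a finite cyclic group are `±1` and `±u_M`, for `M` the
subgroup of index `2`. -/
theorem units_eq_closure_of_isCyclic {C : Type v} [Group C] [IsCyclic C] [Finite C]
    (M : Subgroup C) (hM : M.index = 2) :
    (⊤ : Subgroup (BurnsideRing C)ˣ) = Subgroup.closure {-1, uUnit M hM} := by
  classical
  let _ : CommGroup C := IsCyclic.commGroup
  have hneg : (-1 : (BurnsideRing C)ˣ) ∈ Subgroup.closure {-1, uUnit M hM} :=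
    Subgroup.subset_closure (by simp)
  have hu : uUnit M hM ∈ Subgroup.closure {-1, uUnit M hM} :=
    Subgroup.subset_closure (by simp)
  have huM : ∀ K, mark K (uUnit M hM : BurnsideRing C) = if K ≤ M then -1 else 1 := mark_uElem hM
  have htop : ¬ (⊤ : Subgroup C) ≤ M := fun h => by
    rw [top_le_iff.1 h, Subgroup.index_top] at hM
    norm_num at hM
  have huniq : ∀ N : Subgroup C, N.index = 2 → N = M := fun N hN => by
    refine IsCyclic.subgroup_eq_of_card_eq ?_
    have h1 := N.card_mul_index
    have h2 := M.card_mul_index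
    rw [hN] at h1
    rw [hM] at h2
    omega
  -- Multiplying by `u_M` changes the sign of the mark at `M` and keeps the mark at `⊤`, so one may
  -- assume that both are `1`.
  have hone : ∀ x : (BurnsideRing C)ˣ, mark ⊤ (x : BurnsideRing C) = 1 →
      x ∈ Subgroup.closure {-1, uUnit M hM} := by
    intro x hx
    rcases mark_unit_eq_one_or_neg_one x M with h | h
    · rw [unit_eq_one_of_mark_eq_one x hx fun N hN => huniq N hN ▸ h]
      exact one_mem _
    · have : x * uUnit M hM = 1 := by
        refine unit_eq_one_of_mark_eq_one _ ?_ fun N hN => ?_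
        · rw [Units.val_mul, map_mul, hx, huM, if_neg htop, one_mul]
        · rw [huniq N hN, Units.val_mul, map_mul, h, huM, if_pos le_rfl]
          norm_num
      rw [eq_inv_of_mul_eq_one_left this]
      exact inv_mem hu
  refine (_root_.eq_top_iff.2 fun x _ => ?_).symm
  rcases mark_unit_eq_one_or_neg_one x ⊤ with h | h
  · exact hone x h
  · have := mul_mem hneg (hone (-x) (by rw [Units.val_neg, map_neg, h, neg_neg]))
    simpa using this

/-- Each index-2 subgroup containing `K` contributes `-1`, so the parity of their number decides the
sign. If `|G : K|` is odd there are none, since the index of such a subgroup divides `|G : K|`. -/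
theorem mark_prod_uElem (hG : IsSeminilpotent 2 1 G) (K : Subgroup G) :
    mark K (∏ N ∈ (Set.toFinite {N : Subgroup G | N.index = 2}).toFinset, uElem N) =
      if 2 ∣ K.index then -1 else 1 := by
  classical
  have hprod : mark K (∏ N ∈ (Set.toFinite {N : Subgroup G | N.index = 2}).toFinset, uElem N) =
      ∏ N ∈ (Set.toFinite {N : Subgroup G | N.index = 2}).toFinset, if K ≤ N then -1 else 1 := by
    rw [map_prod]
    exact Finset.prod_congr rfl fun N hN => mark_uElem (by simpa using hN) K
  rw [hprod]
  split_ifs with h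
  · rw [← Finset.prod_filter, Finset.prod_const]
    refine Odd.neg_one_pow (Nat.odd_iff.2 ?_)
    have hodd := (hG K (by rwa [pow_one])).2
    have hcard : Nat.card {N : Subgroup G // N.Normal ∧ K ≤ N ∧ N.index = 2 ^ 1} =
        ((Set.toFinite {N : Subgroup G | N.index = 2}).toFinset.filter (K ≤ ·)).card := by
      refine Nat.subtype_card _ fun N => ?_
      rw [Finset.mem_filter, Set.Finite.mem_toFinset, Set.mem_ofPred_eq, pow_one]
      exact ⟨fun hN => ⟨Subgroup.normal_of_index_eq_two hN.1, hN.2, hN.1⟩,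
        fun hN => ⟨hN.2.2, hN.2.1⟩⟩
    rw [hcard] at hodd
    exact hodd
  · refine Finset.prod_eq_one fun N hN => if_neg fun hKN => h ?_
    have hN2 : N.index = 2 := by simpa using hN
    exact hN2 ▸ Subgroup.index_dvd_of_le hKN

end Units

end BurnsideRing

/-! ### The image of the units under the Frobenius–Wielandt homomorphism -/

open BurnsideRing

theorem theorem6p5 {G : Type u} [Group G] [Finite G] {C : Type v} [Group C] [IsCyclic C]
    (hC : Nat.card C = Nat.card G) (heven : Even (Nat.card G)) (hG : IsSeminilpotent 2 1 G) :
    ∃ α : BurnsideRing C →+* BurnsideRing G,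
      IsFrobeniusWielandt α ∧
      (∀ β : BurnsideRing C →+* BurnsideRing G, IsFrobeniusWielandt β → β = α) ∧
      (Units.map (α : BurnsideRing C →* BurnsideRing G)).range ≤
        (BurnsideRing.partialRing (Nsub G) (isCollection_Nsub G)).toSubmonoid.units ∧
      ∃ v : (BurnsideRing G)ˣ,
        (v : BurnsideRing G) =
          ∏ N ∈ (Set.toFinite {N : Subgroup G | N.index = 2}).toFinset, uElem N ∧
        (Units.map (α : BurnsideRing C →* BurnsideRing G)).range =
          Subgroup.closure {-1, v} := by
  classical
  have : Finite C := Nat.finite_of_card_ne_zero (hC ▸ Nat.card_pos.ne')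
  obtain ⟨α, hα⟩ := exists_isFrobeniusWielandt (G := G) (C := C) hC
  obtain ⟨m, hm⟩ := heven
  obtain ⟨M, hMm⟩ := IsCyclic.exists_subgroup_card_eq (C := C) (d := m) ⟨2, by omega⟩
  have hm0 : 0 < m := hMm ▸ Nat.card_pos
  have hM : M.index = 2 := by
    have h := M.card_mul_index
    rw [hMm, hC, hm, ← mul_two] at h
    exact Nat.eq_of_mul_eq_mul_left hm0 h
  have hval : α (uElem M) =
      ∏ N ∈ (Set.toFinite {N : Subgroup G | N.index = 2}).toFinset, uElem N := by
    refine ext_mark fun K => ?_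
    obtain ⟨L, hL⟩ := IsCyclic.exists_subgroup_card_eq (C := C) (hC ▸ K.card_subgroup_dvd_card)
    rw [hα K L hL, mark_prod_uElem hG, mark_uElem hM]
    -- Since `|K| * |G : K| = 2 * m`, the order `|K|` divides `m` exactly when 2 divides `|G : K|`.
    refine if_congr ?_ rfl rfl
    rw [IsCyclic.subgroup_le_iff_card_dvd, hL, hMm]
    have hK := K.card_mul_index
    rw [hm, ← mul_two] at hK
    constructor
    · rintro ⟨c, hc⟩
      refine ⟨c, Nat.eq_of_mul_eq_mul_left (Nat.card_pos (α := K)) ?_⟩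
      rw [hK, hc]
      ring
    · rintro ⟨c, hc⟩
      refine ⟨c, Nat.eq_of_mul_eq_mul_right two_pos ?_⟩
      rw [← hK, hc]
      ring
  have hneg : Units.map (α : BurnsideRing C →* BurnsideRing G) (-1) = -1 :=
    Units.ext (by simp)
  have hrange : (Units.map (α : BurnsideRing C →* BurnsideRing G)).range =
      Subgroup.closure {-1, Units.map (α : BurnsideRing C →* BurnsideRing G) (uUnit M hM)} := by
    rw [MonoidHom.range_eq_map, units_eq_closure_of_isCyclic M hM, MonoidHom.map_closure,
      Set.image_pair, hneg]
  have hprod : α (uElem M) ∈ partialRing (Nsub G) (isCollection_Nsub G) :=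
    hval ▸ prod_mem fun N hN => uElem_mem_partialRing (by simpa using hN)
  refine ⟨α, hα, fun β hβ => eq_of_isFrobeniusWielandt hC hα hβ, ?_, _, hval, hrange⟩
  rw [hrange, Subgroup.closure_le]
  rintro _ (rfl | rfl)
  · have h : (-1 : BurnsideRing G) ∈ partialRing (Nsub G) (isCollection_Nsub G) :=
      neg_mem (one_mem _)
    exact ⟨h, h⟩
  -- Membership is needed for the unit and its inverse; both are `α (uElem M)`.
  · exact ⟨hprod, hprod⟩
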